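/- **Setting.** Let $g:\mathbb R^n\to\mathbb R$ be $\beta$-strongly convex and $\alpha$-smooth with $\alpha,\beta>0$ (i.e. $g-\frac\beta2\|\cdot\|^2$ is convex and $g-\frac\alpha2\|\cdot\|^2$ is concave). Let $P\subset\mathbb R^n$ be a nonempty polytope, for example the base polytope $B(F)=\{w: w(V)=F(V),\ w(A)\le F(A)\ \forall A\subseteq V\}$ of a submodular $F:2^V\to\mathbb R$ with $V=\{1,\dots,n\}$, $F(\emptyset)=0$ and $w(A)=\sum_{k\in A}w_k$. Put $f(x)=\max_{w\in P}w^\top x$ (for $P=B(F)$ the Lovász extension of $F$), $p^\star=\min_{x\in\mathbb R^n}g(x)+f(x)$, $g^*(w)=\max_x w^\top x-g(x)$ and $h(w)=-g^*(-w)$. **Algorithm (L-FCFW), with tolerance $\epsilon$.** Start with a nonempty $\mathcal V^{(0)}\subseteq\mathrm{vert}(P)$. For $i=1,2,\dots$: let $w^{(i)}$ maximize $h$ over $\mathrm{conv}(\mathcal V^{(i-1)})$ and choose any $\lambda_v\ge0$ $(v\in\mathcal V^{(i-1)})$ with $\sum_v\lambda_v=1$ and $w^{(i)}=\sum_v\lambda_v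 v$; let $x^{(i)}=\nabla h(w^{(i)})$ and let $v^{(i)}\in\mathrm{vert}(P)$ maximize $u^\top x^{(i)}$ over $u\in P$; stop if $(v^{(i)}-w^{(i)})^\top x^{(i)}\le\epsilon$; otherwise choose any set of vertices $\mathcal B^{(i)}\supseteq\{v\in\mathcal V^{(i-1)}:\lambda_v>0\}$ and put $\mathcal V^{(i)}=\mathcal B^{(i)}\cup\{v^{(i)}\}$. The lower bound computed in iteration $i$ is $d^{(i)}=g(x^{(i)})+(w^{(i)})^\top x^{(i)}$. **Diameter and pyramidal width.** Let $M=\max_{v,w\in P}\|v-w\|_2$. For $x\neq0$ and a finite set $S$ let $\mathrm{dirW}(S,x)=\max_{a,b\in S}(a-b)^\top x/\|x\|_2$. For a finite set $\mathcal S$ and $w\in\mathrm{conv}(\mathcal S)$ let $\mathrm{PdirW}(\mathcal S,x,w)=\min_A\mathrm{dirW}(A\cup\{s\},x)$, where $s\in\arg\max_{u\in\mathcal S}u^\top x$ and $A$ ranges over the subsets of $\mathcal S$ such that $w$ is a convex combination of the points of $A$ with all multipliers positive. The pyramidal width of $P$ is $$\delta=\min_{K}\ \min_{w\in K,\ x\in\mathrm{cone}(K-w)\setminus\{0\}}\mathrm{PdirW}(K\cap\mathrm{vert}(P),x,w),$$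 where $K$ ranges over the nonempty faces of $P$. **Theorem.** Let $\rho=\frac{\beta}{4\alpha}\left(\frac{\delta}{M}\right)^2$ (with $\rho=0$ if $P$ is a single point). Then the lower bounds of L-FCFW converge linearly to $p^\star$ at the rate $1-\rho$, whatever the tolerance and the admissible choices made in the algorithm. That is, $\rho>0$ if $P$ has more than one point; $d^{(i)}=h(w^{(i)})\le p^\star$ for every iteration $i\ge1$ that is carried out; and whenever iterations $i$ and $i+1$ are carried out, $$p^\star-d^{(i+1)}\le(1-\rho)\,(p^\star-d^{(i)}).$$ -/

import Mathlib

noncomputable section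

namespace LFCFW

variable {n : ℕ}

/-- The set function `F : 2^V → ℝ`, `V = {1, …, n}`, is submodular. -/
def IsSubmodular (F : Finset (Fin n) → ℝ) : Prop :=
  ∀ A B : Finset (Fin n), F (A ∪ B) + F (A ∩ B) ≤ F A + F B

/-- The base polytope `B(F) = {w : w(V) = F(V), w(A) ≤ F(A) for all A ⊆ V}`. -/
def basePolytope (F : Finset (Fin n) → ℝ) : Set (EuclideanSpace ℝ (Fin n)) :=
  {w | ∑ k, w k = F Finset.univ ∧ ∀ A : Finset (Fin n), ∑ k ∈ A, w k ≤ F A}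

/-- A nonempty polytope: the convex hull of a nonempty finite set of points. -/
def IsPolytope (P : Set (EuclideanSpace ℝ (Fin n))) : Prop :=
  ∃ s : Finset (EuclideanSpace ℝ (Fin n)), s.Nonempty ∧ P = convexHull ℝ (s : Set _)

/-- `g` is `α`-smooth: `g - (α/2)‖·‖²` is concave. -/
def IsSmooth (α : ℝ) (g : EuclideanSpace ℝ (Fin n) → ℝ) : Prop :=
  ConcaveOn ℝ Set.univ (fun x => g x - α / 2 * ‖x‖ ^ 2)

/-- The Fenchel conjugate `g*(w) = sup_x (wᵀx - g(x))`. -/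
def conjugate (g : EuclideanSpace ℝ (Fin n) → ℝ) (w : EuclideanSpace ℝ (Fin n)) : ℝ :=
  ⨆ x, (inner ℝ w x - g x)

/-- The dual objective `h(w) = -g*(-w)`. -/
def dualObjective (g : EuclideanSpace ℝ (Fin n) → ℝ) (w : EuclideanSpace ℝ (Fin n)) : ℝ :=
  -conjugate g (-w)

/-- `f(x) = max_{w ∈ P} wᵀx`; for `P = B(F)` this is the Lovász extension of `F`. -/
def supportFun (P : Set (EuclideanSpace ℝ (Fin n))) (x : EuclideanSpace ℝ (Fin n)) : ℝ :=
  sSup ((fun w => inner ℝ w x) '' P)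

/-- The optimal value `p⋆ = min_x (g(x) + f(x))` of the primal problem. -/
def primalValue (g : EuclideanSpace ℝ (Fin n) → ℝ) (P : Set (EuclideanSpace ℝ (Fin n))) : ℝ :=
  ⨅ x, (g x + supportFun P x)

/-- The directional width `dirW(S, x) = max_{a, b ∈ S} (a - b)ᵀ x / ‖x‖`. -/
def dirWidth (S : Set (EuclideanSpace ℝ (Fin n))) (x : EuclideanSpace ℝ (Fin n)) : ℝ :=
  sSup {r | ∃ a ∈ S, ∃ b ∈ S, r = inner ℝ (a - b) x / ‖x‖}

/-- The finite sets `A ⊆ S` such that `w` is a convex combination of the points of `A` in which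
every point of `A` has a non-zero (that is, positive) multiplier. -/
def activeSets (S : Set (EuclideanSpace ℝ (Fin n))) (w : EuclideanSpace ℝ (Fin n)) :
    Set (Finset (EuclideanSpace ℝ (Fin n))) :=
  {A | (A : Set _) ⊆ S ∧ ∃ c : EuclideanSpace ℝ (Fin n) → ℝ,
    (∀ a ∈ A, 0 < c a) ∧ ∑ a ∈ A, c a = 1 ∧ ∑ a ∈ A, c a • a = w}

/-- The pyramidal directional width: the minimum over active sets `A` of `w` of the directional
width of `A ∪ {s}`, where `s` maximizes `uᵀx` over `u ∈ S` (the value does not depend on which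
maximizer is taken). -/
def pyramidalDirWidth (S : Set (EuclideanSpace ℝ (Fin n))) (x w : EuclideanSpace ℝ (Fin n)) : ℝ :=
  sInf {r | ∃ A ∈ activeSets S w, ∃ s ∈ S, (∀ u ∈ S, inner ℝ u x ≤ inner ℝ s x) ∧
    r = dirWidth (insert s (A : Set _)) x}

/-- For convex `K` and `w ∈ K`, the cone generated by `K - w`: the directions that point from `w`
into `K`. -/
def coneAt (K : Set (EuclideanSpace ℝ (Fin n))) (w : EuclideanSpace ℝ (Fin n)) :
    Set (EuclideanSpace ℝ (Fin n)) :=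
  {x | ∃ y ∈ K, ∃ t : ℝ, 0 ≤ t ∧ x = t • (y - w)}

/-- The pyramidal width of a polytope `P`: the minimum, over the faces `K` of `P`, the points
`w ∈ K` and the non-zero directions `x` in the cone of `K - w`, of the pyramidal directional width
of the vertices of `P` in `K`. (All faces of a polytope are exposed.) -/
def pyramidalWidth (P : Set (EuclideanSpace ℝ (Fin n))) : ℝ :=
  sInf {r | ∃ K, IsExposed ℝ P K ∧ ∃ w ∈ K, ∃ x ∈ coneAt K w, x ≠ 0 ∧
    r = pyramidalDirWidth (K ∩ P.extremePoints ℝ) x w}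

/-- The data of the first `N` iterations, numbered `1, …, N`, of the limited memory fully corrective
Frank-Wolfe method for maximizing `h(w) = -g*(-w)` over the polytope `P` with tolerance `ε`.
The quantities of iteration `i` are `w i`, `lam i`, `x i`, `v i`, `B i`, `V i`; `V 0` is the
initialization. The memory update of iteration `i` takes place only if the method does not stop
in iteration `i`. A negative `ε` gives the method without a stopping test. -/
structure Run (g : EuclideanSpace ℝ (Fin n) → ℝ) (P : Set (EuclideanSpace ℝ (Fin n)))
    (ε : ℝ) (N : ℕ) where
  V : ℕ → Finset (EuclideanSpace ℝ (Fin n))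
  B : ℕ → Finset (EuclideanSpace ℝ (Fin n))
  w : ℕ → EuclideanSpace ℝ (Fin n)
  x : ℕ → EuclideanSpace ℝ (Fin n)
  v : ℕ → EuclideanSpace ℝ (Fin n)
  lam : ℕ → EuclideanSpace ℝ (Fin n) → ℝ
  /-- Initialization: `V 0` is a nonempty set of vertices. -/
  init_nonempty : (V 0).Nonempty
  init_vertices : (V 0 : Set (EuclideanSpace ℝ (Fin n))) ⊆ P.extremePoints ℝ
  /-- Convex subproblem: `w (i+1)` maximizes `h` over `conv (V i)`. -/
  w_mem : ∀ i < N, w (i + 1) ∈ convexHull ℝ (V i : Set (EuclideanSpace ℝ (Fin n)))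
  w_max : ∀ i < N, ∀ u ∈ convexHull ℝ (V i : Set (EuclideanSpace ℝ (Fin n))),
    dualObjective g u ≤ dualObjective g (w (i + 1))
  /-- `lam (i+1)` is some family of convex multipliers that represents `w (i+1)` over `V i`. -/
  lam_nonneg : ∀ i < N, ∀ u ∈ V i, 0 ≤ lam (i + 1) u
  lam_sum : ∀ i < N, ∑ u ∈ V i, lam (i + 1) u = 1
  lam_repr : ∀ i < N, ∑ u ∈ V i, lam (i + 1) u • u = w (i + 1)
  /-- Gradient of `h` at the new iterate. -/
  x_eq : ∀ i < N, x (i + 1) = gradient (dualObjective g) (w (i + 1))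
  /-- Linear subproblem: `v (i+1)` is a vertex of `P` that maximizes `uᵀ x (i+1)` over `P`. -/
  v_vertex : ∀ i < N, v (i + 1) ∈ P.extremePoints ℝ
  v_max : ∀ i < N, ∀ u ∈ P, inner ℝ u (x (i + 1)) ≤ inner ℝ (v (i + 1)) (x (i + 1))
  /-- The stopping test fails in every iteration but possibly the last. -/
  not_stopped : ∀ i, i + 1 < N →
    ε < inner ℝ (v (i + 1)) (x (i + 1)) - inner ℝ (w (i + 1)) (x (i + 1))
  /-- Memory update: `B (i+1)` is any set of vertices that contains the active ones. -/
  B_vertices : ∀ i, i + 1 < N →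
    (B (i + 1) : Set (EuclideanSpace ℝ (Fin n))) ⊆ P.extremePoints ℝ
  B_active : ∀ i, i + 1 < N → ∀ u ∈ V i, 0 < lam (i + 1) u → u ∈ B (i + 1)
  V_update : ∀ i, i + 1 < N →
    (V (i + 1) : Set (EuclideanSpace ℝ (Fin n))) = insert (v (i + 1)) (B (i + 1) : Set _)

/-- The lower bound `d^(i) = g(x^(i)) + (w^(i))ᵀ x^(i)`. -/
def Run.lowerBound {g : EuclideanSpace ℝ (Fin n) → ℝ} {P : Set (EuclideanSpace ℝ (Fin n))}
    {ε : ℝ} {N : ℕ} (R : Run g P ε N) (i : ℕ) : ℝ :=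
  g (R.x i) + inner ℝ (R.w i) (R.x i)

end LFCFW

end

/-! Smoothness of $g$ makes $h$ strongly concave with modulus $1/\alpha$, and strong convexity of
$g$ makes $h$ smooth with constant $1/\beta$ (`dualObjective_upper`, `dualObjective_lower`). By
strong duality $p^\star=h(z)$ for some $z\in P$, and $d^{(i)}=h(w^{(i)})$, so the claim concerns the
dual error $D=p^\star-h(w)$ at $w=w^{(i)}$.

Since $w$ is optimal over the hull of the memory, the gradient $x$ is constant on the active
vertices. Hence the Frank-Wolfe gap $G=(v-w)^\top x$ is also the pairwise gap $(v-a)^\top x$ for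
each active $a$. The geometric core, `pyramidalWidth_mul_inner_le`, then gives $\delta\,(z-w)^\top
x\le G\|z-w\|$, and strong concavity turns this into $\delta^2D\le\alpha G^2/2$.

The next memory retains the active vertices and adds $v$, so the next iterate does at least as well
as line search on $[w,v]$, which gains at least $tG-t^2M^2/(2\beta)$ for every $t\in[0,1]$.
Combining the two bounds (`rate_mul_error_le_progress`) shows that the gain is at least $\rho D$.
Positivity of $\rho$ reduces to $\delta>0$, a compactness statement about finitely many finitely
generated cones. -/

namespace LFCFW

/-! ### Finitely generated cones: closedness, uniform bounds, projection. -/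

section Cone

variable {E : Type*} [NormedAddCommGroup E] [InnerProductSpace ℝ E]

lemma mem_hull_finset {T : Finset E} {x : E} :
    x ∈ PointedCone.hull ℝ (T : Set E) ↔
      ∃ c : E → ℝ, (∀ d ∈ T, 0 ≤ c d) ∧ ∑ d ∈ T, c d • d = x := by
  constructor
  · intro h
    obtain ⟨f, -, hf⟩ := Submodule.mem_span_finset.1 h
    exact ⟨fun d => (f d : ℝ), fun d _ => (f d).2, hf⟩
  · rintro ⟨c, hc, rfl⟩
    refine Submodule.sum_mem _ fun d hd => ?_
    exact Submodule.smul_mem _ (⟨c d, hc d hd⟩ : {r : ℝ // 0 ≤ r})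
      (Submodule.subset_span (Finset.mem_coe.2 hd))

/-- A vector of a conic hull with a linear dependence among its generators does not need one of
the generators. -/
lemma exists_mem_hull_erase [DecidableEq E] {T : Finset E} {x : E}
    (hx : x ∈ PointedCone.hull ℝ (T : Set E)) (hT : ¬ LinearIndepOn ℝ id (T : Set E)) :
    ∃ k ∈ T, x ∈ PointedCone.hull ℝ ((T.erase k : Finset E) : Set E) := by
  obtain ⟨c, hc, rfl⟩ := mem_hull_finset.1 hx
  obtain ⟨f, hf, j, hj, hfj⟩ :
      ∃ f : E → ℝ, ∑ i ∈ T, f i • i = 0 ∧ ∃ j ∈ T, 0 < f j := by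
    rw [linearIndepOn_finset_iff] at hT
    push Not at hT
    obtain ⟨f, hf, j, hj, hfj⟩ := hT
    rcases lt_or_gt_of_ne hfj with h | h
    · refine ⟨fun i => -f i, ?_, j, hj, by simpa using h⟩
      simpa [Finset.sum_neg_distrib] using hf
    · exact ⟨f, hf, j, hj, h⟩
  -- Subtracting the smallest ratio $c_k/f_k$ times the dependence keeps all coefficients
  -- nonnegative and annihilates that of `k`.
  obtain ⟨k, hk, hmin⟩ := Finset.exists_min_image (T.filter fun i => 0 < f i)
    (fun i => c i / f i) ⟨j, by simp [hj, hfj]⟩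
  rw [Finset.mem_filter] at hk
  refine ⟨k, hk.1, mem_hull_finset.2 ⟨fun i => c i - c k / f k * f i, fun i hi => ?_, ?_⟩⟩
  · have hiT := Finset.mem_of_mem_erase hi
    have hck : 0 ≤ c k / f k := div_nonneg (hc k hk.1) hk.2.le
    rcases le_or_gt (f i) 0 with h | h
    · nlinarith [hc i hiT]
    · have := hmin i (by simp [hiT, h])
      rw [le_div_iff₀ h] at this
      linarith
  · have h0 : (c k - c k / f k * f k) • k = 0 := by
      rw [div_mul_cancel₀ _ hk.2.ne', sub_self, zero_smul]
    rw [Finset.sum_erase (f := fun i => (c i - c k / f k * f i) • i) T h0]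
    simp only [sub_smul, Finset.sum_sub_distrib, mul_smul, ← Finset.smul_sum, hf, smul_zero,
      sub_zero]

/-- The conic version of Carathéodory's theorem. -/
lemma exists_linearIndepOn_mem_hull (T : Finset E) {x : E}
    (hx : x ∈ PointedCone.hull ℝ (T : Set E)) :
    ∃ T' ⊆ T, LinearIndepOn ℝ id (T' : Set E) ∧ x ∈ PointedCone.hull ℝ (T' : Set E) := by
  classical
  induction T using Finset.strongInduction with
  | H T ih =>
    by_cases hT : LinearIndepOn ℝ id (T : Set E)
    · exact ⟨T, subset_rfl, hT, hx⟩
    · obtain ⟨k, hk, hxk⟩ := exists_mem_hull_erase hx hT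
      obtain ⟨T', hT', h⟩ := ih _ (Finset.erase_ssubset hk) hxk
      exact ⟨T', hT'.trans (Finset.erase_subset _ _), h⟩

/-- The cone is the image of the nonnegative orthant under an injective linear map, which is a
closed embedding in finite dimension. -/
lemma isClosed_hull_of_linearIndepOn {T : Finset E} (hT : LinearIndepOn ℝ id (T : Set E)) :
    IsClosed (PointedCone.hull ℝ (T : Set E) : Set E) := by
  have hemb := LinearMap.isClosedEmbedding_of_injective
    (f := Fintype.linearCombination ℝ (fun i : T => (i : E)))
    (LinearMap.ker_eq_bot.2 (linearIndependent_iff_injective_fintypeLinearCombination.1 hT))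
  have himg : (PointedCone.hull ℝ (T : Set E) : Set E) =
      Fintype.linearCombination ℝ (fun i : T => (i : E)) '' {c | ∀ i, 0 ≤ c i} := by
    ext x
    rw [SetLike.mem_coe, mem_hull_finset]
    constructor
    · rintro ⟨c, hc, rfl⟩
      refine ⟨fun i => c i, fun i => hc i i.2, ?_⟩
      rw [Fintype.linearCombination_apply, Finset.sum_coe_sort T (fun i => c i • i)]
    · rintro ⟨c, hc, rfl⟩
      classical
      refine ⟨fun d => if h : d ∈ T then c ⟨d, h⟩ else 0, fun d hd => ?_, ?_⟩
      · simpa [hd] using hc ⟨d, hd⟩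
      · rw [Fintype.linearCombination_apply, ← Finset.sum_coe_sort T]
        exact Finset.sum_congr rfl fun i _ => by simp
  rw [himg]
  refine hemb.isClosedMap _ ?_
  simp only [Set.ofPred_forall]
  exact isClosed_iInter fun i => isClosed_le continuous_const (continuous_apply i)

/-- A finitely generated cone is closed. -/
lemma isClosed_hull_finset (T : Finset E) : IsClosed (PointedCone.hull ℝ (T : Set E) : Set E) := by
  -- By Carathéodory the cone is a finite union of simplicial cones.
  have : (PointedCone.hull ℝ (T : Set E) : Set E) =
      ⋃ T' ∈ {T' : Finset E | T' ⊆ T ∧ LinearIndepOn ℝ id (T' : Set E)},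
        (PointedCone.hull ℝ (T' : Set E) : Set E) := by
    ext x
    simp only [Set.mem_iUnion, SetLike.mem_coe, Set.mem_ofPred_eq, exists_prop]
    constructor
    · intro hx
      obtain ⟨T', h1, h2, h3⟩ := exists_linearIndepOn_mem_hull T hx
      exact ⟨T', ⟨h1, h2⟩, h3⟩
    · rintro ⟨T', ⟨h1, -⟩, h3⟩
      exact Submodule.span_mono (Finset.coe_subset.2 h1) h3
  rw [this]
  refine Set.Finite.isClosed_biUnion ?_ fun T' hT' => isClosed_hull_of_linearIndepOn hT'.2
  exact (T.powerset.finite_toSet).subset fun T' hT' => by simpa using hT'.1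

/-- Expanding one factor of $\|x\|^2>0$ in the generators leaves a positive term. -/
lemma exists_inner_pos_of_mem_hull {T : Finset E} {x : E}
    (hx : x ∈ PointedCone.hull ℝ (T : Set E)) (hx0 : x ≠ 0) : ∃ d ∈ T, 0 < inner ℝ d x := by
  obtain ⟨c, hc, hsum⟩ := mem_hull_finset.1 hx
  by_contra! h
  have h1 : inner ℝ x x = ∑ d ∈ T, c d * inner ℝ d x := by
    conv_lhs => rw [← hsum, sum_inner]
    simp [real_inner_smul_left, hsum]
  have h2 : ∑ d ∈ T, c d * inner ℝ d x ≤ 0 :=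
    Finset.sum_nonpos fun d hd => mul_nonpos_of_nonneg_of_nonpos (hc d hd) (h d hd)
  exact (real_inner_self_pos.2 hx0).not_ge (h1 ▸ h2)

/-- The largest inner product with a generator is continuous and positive on the compact set of unit
vectors of the cone, so it has a positive minimum there; the general case follows by scaling. -/
lemma exists_const_le_inner_of_mem_hull [FiniteDimensional ℝ E] (T : Finset E) :
    ∃ c : ℝ, 0 < c ∧ ∀ x ∈ PointedCone.hull ℝ (T : Set E), x ≠ 0 →
      ∃ d ∈ T, c * ‖x‖ ≤ inner ℝ d x := by
  set C : Set E := (PointedCone.hull ℝ (T : Set E) : Set E) ∩ Metric.sphere 0 1 with hC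
  have hnorm : ∀ x ∈ PointedCone.hull ℝ (T : Set E), x ≠ 0 → ‖x‖⁻¹ • x ∈ C := fun x hx hx0 =>
    ⟨Submodule.smul_mem _ (⟨‖x‖⁻¹, by positivity⟩ : {r : ℝ // 0 ≤ r}) hx, by
      simp [norm_smul, hx0]⟩
  rcases C.eq_empty_or_nonempty with hCe | hCne
  · refine ⟨1, one_pos, fun x hx hx0 => ?_⟩
    have := hnorm x hx hx0
    simp [hCe] at this
  have hT : T.Nonempty := by
    obtain ⟨x, hx, hx1⟩ := hCne
    obtain ⟨d, hd, -⟩ := exists_inner_pos_of_mem_hull hx (by rintro rfl; simp at hx1)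
    exact ⟨d, hd⟩
  have hcomp : IsCompact C := (isCompact_sphere 0 1).inter_left (isClosed_hull_finset T)
  have hcont : Continuous fun x : E => T.sup' hT fun d => inner ℝ d x :=
    Continuous.finset_sup'_apply hT fun d _ => by fun_prop
  obtain ⟨x₀, hx₀, hmin⟩ := hcomp.exists_isMinOn hCne hcont.continuousOn
  refine ⟨T.sup' hT fun d => inner ℝ d x₀, ?_, fun x hx hx0 => ?_⟩
  · obtain ⟨d, hd, hpos⟩ := exists_inner_pos_of_mem_hull hx₀.1 (by
      rintro rfl; simpa using hx₀.2)
    exact (Finset.lt_sup'_iff hT).2 ⟨d, hd, hpos⟩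
  · obtain ⟨d, hd, hdeq⟩ := Finset.exists_mem_eq_sup' hT fun d => inner ℝ d (‖x‖⁻¹ • x)
    have h : (T.sup' hT fun d => inner ℝ d x₀) ≤ T.sup' hT fun d => inner ℝ d (‖x‖⁻¹ • x) :=
      hmin (hnorm x hx hx0)
    rw [hdeq, real_inner_smul_right] at h
    refine ⟨d, hd, ?_⟩
    rwa [inv_mul_eq_div, le_div_iff₀ (norm_pos_iff.2 hx0)] at h

/-- The constant can be chosen uniformly for all subfamilies of a finite set of generators. -/
lemma exists_uniform_const_le_inner_of_mem_hull [FiniteDimensional ℝ E] (D : Finset E) :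
    ∃ c : ℝ, 0 < c ∧ ∀ T ⊆ D, ∀ x ∈ PointedCone.hull ℝ (T : Set E), x ≠ 0 →
      ∃ d ∈ T, c * ‖x‖ ≤ inner ℝ d x := by
  choose c hc h using fun T : Finset E => exists_const_le_inner_of_mem_hull T
  obtain ⟨T₀, -, hT₀⟩ := Finset.exists_min_image D.powerset c ⟨∅, by simp⟩
  refine ⟨c T₀, hc T₀, fun T hT x hx hx0 => ?_⟩
  obtain ⟨d, hd, hle⟩ := h T x hx hx0
  exact ⟨d, hd, le_trans (by gcongr; exact hT₀ T (by simpa using hT)) hle⟩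

/-- Orthogonal projection onto a closed cone (Moreau). -/
lemma exists_projection_of_isClosed_cone [CompleteSpace E] (C : PointedCone ℝ E)
    (hC : IsClosed (C : Set E)) (r : E) :
    ∃ q ∈ C, inner ℝ (r - q) q = 0 ∧ ∀ u ∈ C, inner ℝ (r - q) u ≤ 0 := by
  have hconv : Convex ℝ (C : Set E) := PointedCone.convex C
  obtain ⟨q, hq, hmin⟩ := exists_norm_eq_iInf_of_complete_convex ⟨0, C.zero_mem⟩
    hC.isComplete hconv r
  have h := (norm_eq_iInf_iff_real_inner_le_zero hconv hq).1 hmin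
  -- Testing the variational inequality at $0$ and at $2q$ yields orthogonality.
  have h0 := h 0 C.zero_mem
  have h2 := h (q + q) (C.add_mem hq hq)
  rw [zero_sub, inner_neg_right] at h0
  rw [add_sub_cancel_right] at h2
  have horth : inner ℝ (r - q) q = 0 := le_antisymm h2 (by linarith)
  refine ⟨q, hq, horth, fun u hu => ?_⟩
  have := h u hu
  rw [inner_sub_right, horth] at this
  linarith

end Cone

end LFCFW

namespace LFCFW

variable {n : ℕ}

/-! ### Base polytopes are compact and convex with finitely many vertices. -/

section BasePolytope

lemma isCompact_basePolytope (F : Finset (Fin n) → ℝ) : IsCompact (basePolytope F) := by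
  have hclosed : IsClosed (basePolytope F) := by
    have h : basePolytope F = {w | ∑ k, w k = F Finset.univ} ∩
        ⋂ A : Finset (Fin n), {w | ∑ k ∈ A, w k ≤ F A} := by
      ext w; simp [basePolytope]
    rw [h]
    refine (isClosed_eq (by fun_prop) continuous_const).inter (isClosed_iInter fun A => ?_)
    exact isClosed_le (by fun_prop) continuous_const
  -- The lower bound on $w_k$ comes from $w(V)=F(V)$ and $w(V\setminus k)\le F(V\setminus k)$.
  have hbox : IsCompact (WithLp.toLp 2 '' Set.Icc
      (fun k => F Finset.univ - F (Finset.univ.erase k)) (fun k => F {k})) :=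
    isCompact_Icc.image (PiLp.continuous_toLp 2 _)
  refine hbox.of_isClosed_subset hclosed fun w hw => ⟨w.ofLp, ⟨fun k => ?_, fun k => ?_⟩, rfl⟩
  · have h1 := Finset.add_sum_erase Finset.univ (fun k => w k) (Finset.mem_univ k)
    have h2 := hw.2 (Finset.univ.erase k)
    rw [hw.1] at h1
    simp only
    linarith
  · simpa using hw.2 {k}

lemma convex_basePolytope (F : Finset (Fin n) → ℝ) : Convex ℝ (basePolytope F) := by
  intro u hu v hv a b ha hb hab
  have hsum : ∀ A : Finset (Fin n), ∑ k ∈ A, (a • u + b • v) k =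
      a * ∑ k ∈ A, u k + b * ∑ k ∈ A, v k := fun A => by
    simp [Finset.sum_add_distrib, Finset.mul_sum]
  refine ⟨?_, fun A => ?_⟩
  · rw [hsum, hu.1, hv.1, ← add_mul, hab, one_mul]
  · rw [hsum]
    calc a * ∑ k ∈ A, u k + b * ∑ k ∈ A, v k ≤ a * F A + b * F A := by
          gcongr
          exacts [hu.2 A, hv.2 A]
      _ = F A := by rw [← add_mul, hab, one_mul]

/-- An extreme point of the base polytope is determined by its tight sets. -/
lemma injOn_tightSets_basePolytope (F : Finset (Fin n) → ℝ) :
    Set.InjOn (fun w : EuclideanSpace ℝ (Fin n) => {A : Finset (Fin n) | ∑ k ∈ A, w k = F A})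
      ((basePolytope F).extremePoints ℝ) := by
  intro w hw w' hw' heq
  have hwP := hw.1
  have hwP' := hw'.1
  -- With equal tight sets, a small move from `w` away from `w'` leaves the tight constraints tight
  -- and the others satisfied. Then `w` lies in an open segment of the polytope ending at `w'`.
  have hev : ∀ᶠ t : ℝ in nhdsWithin 0 (Set.Ioi 0), ∀ A : Finset (Fin n),
      ∑ k ∈ A, w k + t * (∑ k ∈ A, w k - ∑ k ∈ A, w' k) ≤ F A := by
    rw [Filter.eventually_all]
    intro A
    by_cases hA : ∑ k ∈ A, w k = F A
    · have hA' : ∑ k ∈ A, w' k = F A := (Set.ext_iff.1 heq A).1 hA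
      simp [hA, hA']
    · have hlt : ∑ k ∈ A, w k + 0 * (∑ k ∈ A, w k - ∑ k ∈ A, w' k) < F A := by
        simpa using lt_of_le_of_ne (hwP.2 A) hA
      have hcont : Continuous fun t : ℝ =>
          ∑ k ∈ A, w k + t * (∑ k ∈ A, w k - ∑ k ∈ A, w' k) := by fun_prop
      exact ((hcont.tendsto 0).mono_left nhdsWithin_le_nhds |>.eventually_lt_const hlt).mono
        fun t ht => ht.le
  obtain ⟨t, ht, ht0⟩ := (hev.and self_mem_nhdsWithin).exists
  have ht0 : 0 < t := ht0
  have hsum : ∀ A : Finset (Fin n), ∑ k ∈ A, (w + t • (w - w')) k =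
      ∑ k ∈ A, w k + t * (∑ k ∈ A, w k - ∑ k ∈ A, w' k) := fun A => by
    simp [Finset.sum_add_distrib, Finset.mul_sum, mul_sub, Finset.sum_sub_distrib]
  have hmem : w + t • (w - w') ∈ basePolytope F :=
    ⟨by rw [hsum, hwP.1, hwP'.1]; ring, fun A => (hsum A).trans_le (ht A)⟩
  refine (((mem_extremePoints.1 hw).2 _ hmem _ hwP' ?_).2).symm
  refine ⟨1 / (1 + t), t / (1 + t), by positivity, by positivity, by field_simp, ?_⟩
  have h1 : (1 : ℝ) + t ≠ 0 := by positivity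
  ext k
  simp only [PiLp.add_apply, PiLp.smul_apply, PiLp.sub_apply, smul_eq_mul]
  field_simp
  ring

lemma finite_extremePoints_basePolytope (F : Finset (Fin n) → ℝ) :
    ((basePolytope F).extremePoints ℝ).Finite :=
  Set.Finite.of_finite_image (Set.toFinite _) (injOn_tightSets_basePolytope F)

end BasePolytope

/-- These three properties are all that the argument needs to know about the shape of $P$. -/
lemma compact_convex_finite_extremePoints {P : Set (EuclideanSpace ℝ (Fin n))}
    (hP : IsPolytope P ∨ ∃ F : Finset (Fin n) → ℝ, P = basePolytope F) :
    IsCompact P ∧ Convex ℝ P ∧ (P.extremePoints ℝ).Finite := by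
  rcases hP with ⟨s, -, rfl⟩ | ⟨F, rfl⟩
  · exact ⟨s.finite_toSet.isCompact_convexHull ℝ, convex_convexHull ℝ _,
      s.finite_toSet.subset extremePoints_convexHull_subset⟩
  · exact ⟨isCompact_basePolytope F, convex_basePolytope F, finite_extremePoints_basePolytope F⟩

/-! ### Faces and their cones of directions. -/

section Faces

variable {P K : Set (EuclideanSpace ℝ (Fin n))}

/-- Krein-Milman on the face; the hull of finitely many points is already closed. -/
lemma IsExposed.eq_convexHull (hc : IsCompact P) (hconv : Convex ℝ P)
    (hfin : (P.extremePoints ℝ).Finite) (hK : IsExposed ℝ P K) :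
    K = convexHull ℝ (K ∩ P.extremePoints ℝ) := by
  have h := closure_convexHull_extremePoints (hK.isCompact hc) (hK.convex hconv)
  rw [hK.isExtreme.extremePoints_eq,
    ((hfin.subset Set.inter_subset_right).isClosed_convexHull ℝ).closure_eq] at h
  exact h.symm

lemma eq_convexHull_extremePoints (hc : IsCompact P) (hconv : Convex ℝ P)
    (hfin : (P.extremePoints ℝ).Finite) : P = convexHull ℝ (P.extremePoints ℝ) := by
  have h := IsExposed.eq_convexHull hc hconv hfin (IsExposed.refl P)
  rwa [Set.inter_eq_right.2 extremePoints_subset] at h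

open Pointwise in
-- Generating directions by $S-A$ instead of $S-w$ leaves only finitely many cones to consider as
-- $w$ varies.
lemma sub_mem_hull {S A : Set (EuclideanSpace ℝ (Fin n))} {y w : EuclideanSpace ℝ (Fin n)}
    (hy : y ∈ convexHull ℝ S) (hw : w ∈ convexHull ℝ A) :
    y - w ∈ PointedCone.hull ℝ (S - A) := by
  have h : y - w ∈ convexHull ℝ (S - A) := by
    rw [convexHull_sub]
    exact Set.sub_mem_sub hy hw
  exact convexHull_min Submodule.subset_span (PointedCone.convex _) h

open Pointwise in
lemma mem_coneAt_of_mem_hull {S : Set (EuclideanSpace ℝ (Fin n))} (hconv : Convex ℝ P)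
    (hS : S ⊆ P) {w q : EuclideanSpace ℝ (Fin n)} (hw : w ∈ P)
    (hq : q ∈ PointedCone.hull ℝ (S - {w})) : q ∈ coneAt P w := by
  induction hq using Submodule.span_induction with
  | mem x hx =>
    obtain ⟨y, hy, -, rfl, rfl⟩ := hx
    exact ⟨y, hS hy, 1, zero_le_one, by simp⟩
  | zero => exact ⟨w, hw, 0, le_rfl, by simp⟩
  | smul a x _ hx =>
    obtain ⟨y, hy, t, ht, rfl⟩ := hx
    exact ⟨y, hy, a * t, mul_nonneg a.2 ht, by rw [mul_smul]; rfl⟩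
  | add x x' _ _ hx hx' =>
    obtain ⟨y, hy, t, ht, rfl⟩ := hx
    obtain ⟨y', hy', t', ht', rfl⟩ := hx'
    rcases (add_nonneg ht ht').eq_or_lt with h0 | h0
    · obtain rfl : t = 0 := by linarith
      obtain rfl : t' = 0 := by linarith
      exact ⟨w, hw, 0, le_rfl, by simp⟩
    · refine ⟨(t / (t + t')) • y + (t' / (t + t')) • y',
        hconv hy hy' (by positivity) (by positivity) (by field_simp), t + t', h0.le, ?_⟩
      ext k
      simp only [PiLp.add_apply, PiLp.smul_apply, PiLp.sub_apply, smul_eq_mul]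
      field_simp
      ring

end Faces

/-! ### Active sets and complementary slackness. -/

section ActiveSets

variable {S : Set (EuclideanSpace ℝ (Fin n))} {w : EuclideanSpace ℝ (Fin n)}
  {A : Finset (EuclideanSpace ℝ (Fin n))}

lemma filter_pos_mem_activeSets {T : Finset (EuclideanSpace ℝ (Fin n))}
    {c : EuclideanSpace ℝ (Fin n) → ℝ} (hT : (T : Set _) ⊆ S) (hc : ∀ a ∈ T, 0 ≤ c a)
    (hsum : ∑ a ∈ T, c a = 1) (hw : ∑ a ∈ T, c a • a = w) :
    T.filter (fun a => 0 < c a) ∈ activeSets S w := by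
  have h0 : ∀ a ∈ T, ¬ 0 < c a → c a = 0 := fun a ha h => le_antisymm (not_lt.1 h) (hc a ha)
  refine ⟨fun a ha => hT (Finset.mem_of_mem_filter a ha), c,
    fun a ha => (Finset.mem_filter.1 ha).2, ?_, ?_⟩
  · rw [Finset.sum_filter_of_ne, hsum]
    exact fun a ha h => not_not.1 fun h' => h (h0 a ha h')
  · rw [Finset.sum_filter_of_ne, hw]
    exact fun a ha h => not_not.1 fun h' => h (by rw [h0 a ha h', zero_smul])

lemma activeSets_nonempty (hS : S.Finite) (hw : w ∈ convexHull ℝ S) :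
    (activeSets S w).Nonempty := by
  rw [← hS.coe_toFinset, Finset.mem_convexHull'] at hw
  obtain ⟨c, hc, hsum, hw⟩ := hw
  exact ⟨_, filter_pos_mem_activeSets hS.coe_toFinset.subset hc hsum hw⟩

lemma nonempty_of_mem_activeSets (hA : A ∈ activeSets S w) : A.Nonempty := by
  obtain ⟨-, c, -, hsum, -⟩ := hA
  rw [Finset.nonempty_iff_ne_empty]
  rintro rfl
  simp at hsum

lemma mem_convexHull_of_mem_activeSets (hA : A ∈ activeSets S w) :
    w ∈ convexHull ℝ (A : Set (EuclideanSpace ℝ (Fin n))) := by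
  obtain ⟨-, c, hc, hsum, hw⟩ := hA
  exact Finset.mem_convexHull'.2 ⟨c, fun a ha => (hc a ha).le, hsum, hw⟩

/-- Complementary slackness: a linear functional that is maximal at `w` over an active set of `w`
is constant on that active set. -/
lemma inner_eq_of_mem_activeSets (hA : A ∈ activeSets S w) {m : EuclideanSpace ℝ (Fin n)}
    (hm : ∀ a ∈ A, inner ℝ a m ≤ inner ℝ w m) : ∀ a ∈ A, inner ℝ a m = inner ℝ w m := by
  obtain ⟨-, c, hc, hsum, hw⟩ := hA
  have h0 : ∑ a ∈ A, c a * (inner ℝ w m - inner ℝ a m) = 0 := by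
    simp only [mul_sub, Finset.sum_sub_distrib, ← Finset.sum_mul, hsum, one_mul]
    conv_lhs => rw [← hw, sum_inner]
    simp [real_inner_smul_left]
  intro a ha
  have h := (Finset.sum_eq_zero_iff_of_nonneg fun b hb =>
    mul_nonneg (hc b hb).le (sub_nonneg.2 (hm b hb))).1 h0 a ha
  have := (mul_eq_zero.1 h).resolve_left (hc a ha).ne'
  linarith

end ActiveSets

/-! ### Pyramidal width: positivity and the gap inequality. -/

section Widths

lemma dirWidth_nonneg (S : Set (EuclideanSpace ℝ (Fin n))) (x : EuclideanSpace ℝ (Fin n)) :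
    0 ≤ dirWidth S x := by
  rcases S.eq_empty_or_nonempty with rfl | ⟨a, ha⟩
  · simp [dirWidth]
  · exact Real.sSup_nonneg' ⟨0, ⟨a, ha, a, ha, by simp⟩, le_rfl⟩

lemma le_dirWidth {S : Set (EuclideanSpace ℝ (Fin n))} (hS : S.Finite)
    {a b : EuclideanSpace ℝ (Fin n)} (ha : a ∈ S) (hb : b ∈ S) (x : EuclideanSpace ℝ (Fin n)) :
    inner ℝ (a - b) x / ‖x‖ ≤ dirWidth S x := by
  refine le_csSup (Set.Finite.bddAbove ?_) ⟨a, ha, b, hb, rfl⟩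
  refine (hS.image2 (fun a b => inner ℝ (a - b) x / ‖x‖) hS).subset ?_
  rintro r ⟨a, ha, b, hb, rfl⟩
  exact ⟨a, ha, b, hb, rfl⟩

lemma pyramidalDirWidth_nonneg (S : Set (EuclideanSpace ℝ (Fin n)))
    (x w : EuclideanSpace ℝ (Fin n)) : 0 ≤ pyramidalDirWidth S x w := by
  refine Real.sInf_nonneg ?_
  rintro r ⟨A, -, s, -, -, rfl⟩
  exact dirWidth_nonneg _ _

lemma pyramidalWidth_nonneg (P : Set (EuclideanSpace ℝ (Fin n))) : 0 ≤ pyramidalWidth P := by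
  refine Real.sInf_nonneg ?_
  rintro r ⟨K, -, w, -, x, -, -, rfl⟩
  exact pyramidalDirWidth_nonneg _ _ _

lemma pyramidalWidth_le_dirWidth {P K : Set (EuclideanSpace ℝ (Fin n))} (hK : IsExposed ℝ P K)
    {w x s : EuclideanSpace ℝ (Fin n)} (hw : w ∈ K) (hx : x ∈ coneAt K w) (hx0 : x ≠ 0)
    {A : Finset (EuclideanSpace ℝ (Fin n))} (hA : A ∈ activeSets (K ∩ P.extremePoints ℝ) w)
    (hs : s ∈ K ∩ P.extremePoints ℝ)
    (hmax : ∀ u ∈ K ∩ P.extremePoints ℝ, inner ℝ u x ≤ inner ℝ s x) :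
    pyramidalWidth P ≤ dirWidth (insert s (A : Set (EuclideanSpace ℝ (Fin n)))) x := by
  calc pyramidalWidth P ≤ pyramidalDirWidth (K ∩ P.extremePoints ℝ) x w := by
        refine csInf_le ⟨0, ?_⟩ ⟨K, hK, w, hw, x, hx, hx0, rfl⟩
        rintro r ⟨K, -, w, -, x, -, -, rfl⟩
        exact pyramidalDirWidth_nonneg _ _ _
    _ ≤ dirWidth (insert s (A : Set (EuclideanSpace ℝ (Fin n)))) x := by
        refine csInf_le ⟨0, ?_⟩ ⟨A, hA, s, hs, hmax, rfl⟩
        rintro r ⟨A, -, s, -, -, rfl⟩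
        exact dirWidth_nonneg _ _

variable {P : Set (EuclideanSpace ℝ (Fin n))}

open Pointwise in
-- Every admissible direction lies in a cone generated by differences of vertices. There are
-- finitely many such cones, so one constant bounds all the widths from below.
theorem pyramidalWidth_pos (hc : IsCompact P) (hconv : Convex ℝ P)
    (hfin : (P.extremePoints ℝ).Finite) (hP : P.Nontrivial) : 0 < pyramidalWidth P := by
  classical
  set V := hfin.toFinset with hV
  obtain ⟨c, hc0, hcone⟩ := exists_uniform_const_le_inner_of_mem_hull (V - V)
  refine hc0.trans_le (le_csInf ?_ ?_)
  · obtain ⟨w, hw, y, hy, hne⟩ := hP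
    exact ⟨_, P, IsExposed.refl P, w, hw, y - w, ⟨y, hy, 1, zero_le_one, by simp⟩,
      sub_ne_zero.2 hne.symm, rfl⟩
  rintro r ⟨K, hK, w, hw, x, ⟨y, hy, t, ht, rfl⟩, hx0, rfl⟩
  have hKfin : (K ∩ P.extremePoints ℝ).Finite := hfin.subset Set.inter_subset_right
  have hKhull := IsExposed.eq_convexHull hc hconv hfin hK
  rw [hKhull] at hw hy
  refine le_csInf ?_ ?_
  · obtain ⟨A, hA⟩ := activeSets_nonempty hKfin hw
    obtain ⟨a, ha⟩ := nonempty_of_mem_activeSets hA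
    obtain ⟨s, hs, hmax⟩ := Set.exists_max_image (K ∩ P.extremePoints ℝ)
      (fun u => inner ℝ u (t • (y - w))) hKfin ⟨a, hA.1 ha⟩
    exact ⟨_, A, hA, s, hs, hmax, rfl⟩
  rintro r ⟨A, hA, s, hs, hmax, rfl⟩
  have hAV : A ⊆ V := fun a ha => hfin.mem_toFinset.2 (hA.1 ha).2
  have hKV : hKfin.toFinset ⊆ V := fun a ha => hfin.mem_toFinset.2 (hKfin.mem_toFinset.1 ha).2
  have hmem : t • (y - w) ∈ PointedCone.hull ℝ ((hKfin.toFinset - A : Finset _) : Set _) := by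
    rw [Finset.coe_sub, hKfin.coe_toFinset]
    exact Submodule.smul_mem _ (⟨t, ht⟩ : {r : ℝ // 0 ≤ r})
      (sub_mem_hull hy (mem_convexHull_of_mem_activeSets hA))
  obtain ⟨d, hd, hle⟩ := hcone _ (Finset.sub_subset_sub hKV hAV) _ hmem hx0
  obtain ⟨s', hs', a, ha, rfl⟩ := Finset.mem_sub.1 hd
  refine le_trans ?_ (le_dirWidth (A.finite_toSet.insert s) (Set.mem_insert s _)
    (Set.mem_insert_of_mem s ha) _)
  rw [le_div_iff₀ (norm_pos_iff.2 hx0)]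
  have := hmax s' (hKfin.mem_toFinset.1 hs')
  rw [inner_sub_left] at hle ⊢
  linarith

open Pointwise in
/-- The pyramidal width bounds the pairwise gap of any direction `r` at `w` from below by the slope
of `r` towards any other point `y` of the polytope. -/
theorem pyramidalWidth_mul_inner_le (hc : IsCompact P) (hconv : Convex ℝ P)
    (hfin : (P.extremePoints ℝ).Finite) {w y r : EuclideanSpace ℝ (Fin n)} {G : ℝ}
    {A : Finset (EuclideanSpace ℝ (Fin n))} (hA : A ∈ activeSets (P.extremePoints ℝ) w)
    (hy : y ∈ P) (hG : ∀ s ∈ P, ∀ a ∈ A, inner ℝ (s - a) r ≤ G) :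
    pyramidalWidth P * inner ℝ (y - w) r ≤ G * ‖y - w‖ := by
  classical
  have hP := eq_convexHull_extremePoints hc hconv hfin
  have hAP : ∀ a ∈ A, a ∈ P := fun a ha => (hA.1 ha).1
  have hwP : w ∈ P :=
    convexHull_min (fun a ha => hAP a ha) hconv (mem_convexHull_of_mem_activeSets hA)
  obtain ⟨a₀, ha₀⟩ := nonempty_of_mem_activeSets hA
  have hG0 : 0 ≤ G := by simpa using hG a₀ (hAP a₀ ha₀) a₀ ha₀
  have hclosed : IsClosed (PointedCone.hull ℝ (P.extremePoints ℝ - {w}) :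
      Set (EuclideanSpace ℝ (Fin n))) := by
    have := isClosed_hull_finset (hfin.toFinset - {w})
    rwa [Finset.coe_sub, hfin.coe_toFinset, Finset.coe_singleton] at this
  -- Moreau decomposition: `q` is the feasible part of `r` at `w`, and `m` lies in the polar cone.
  obtain ⟨q, hq, horth, hpolar⟩ := exists_projection_of_isClosed_cone _ hclosed r
  set m := r - q with hm
  have hpol : ∀ z ∈ P, inner ℝ (z - w) m ≤ 0 := fun z hz => by
    rw [real_inner_comm]
    exact hpolar _ (sub_mem_hull (hP ▸ hz) (by simp))
  have hslope : inner ℝ (y - w) r ≤ ‖y - w‖ * ‖q‖ := by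
    have h1 := hpol y hy
    have h2 := real_inner_le_norm (y - w) q
    rw [hm, inner_sub_right] at h1
    linarith
  suffices h : pyramidalWidth P * ‖q‖ ≤ G by
    calc pyramidalWidth P * inner ℝ (y - w) r ≤ pyramidalWidth P * (‖y - w‖ * ‖q‖) := by
          gcongr
          exact pyramidalWidth_nonneg P
      _ = pyramidalWidth P * ‖q‖ * ‖y - w‖ := by ring
      _ ≤ G * ‖y - w‖ := by gcongr
  rcases eq_or_ne q 0 with rfl | hq0
  · simpa using hG0
  -- The face exposed by `m` contains `w`, hence its active set, and `q` points into it because `q`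
  -- is orthogonal to `m`.
  let K : Set (EuclideanSpace ℝ (Fin n)) :=
    {u ∈ P | ∀ z ∈ P, innerSL ℝ m z ≤ innerSL ℝ m u}
  have hK : IsExposed ℝ P K := fun _ => ⟨innerSL ℝ m, rfl⟩
  have hKmem : ∀ u ∈ P, inner ℝ u m = inner ℝ w m → u ∈ K := fun u hu h => by
    refine ⟨hu, fun z hz => ?_⟩
    have := hpol z hz
    rw [inner_sub_left, ← h] at this
    rw [innerSL_apply_apply, innerSL_apply_apply, real_inner_comm, real_inner_comm u]
    linarith
  have hKeq : ∀ u ∈ K, inner ℝ u m = inner ℝ w m := fun u hu => by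
    have h1 := hpol u hu.1
    have h2 := hu.2 w hwP
    rw [innerSL_apply_apply, innerSL_apply_apply, real_inner_comm, real_inner_comm u] at h2
    rw [inner_sub_left] at h1
    linarith
  have hAK : ∀ a ∈ A, a ∈ K := fun a ha => hKmem a (hAP a ha) <|
    inner_eq_of_mem_activeSets hA (fun b hb => by
      have := hpol b (hAP b hb)
      rw [inner_sub_left] at this
      linarith) a ha
  have hqK : q ∈ coneAt K w := by
    obtain ⟨z, hz, t, ht, rfl⟩ := mem_coneAt_of_mem_hull hconv extremePoints_subset hwP hq
    refine ⟨z, hKmem z hz ?_, t, ht, rfl⟩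
    rw [real_inner_comm, real_inner_smul_left, inner_sub_left] at horth
    have ht0 : t ≠ 0 := by rintro rfl; simp at hq0
    have := (mul_eq_zero.1 horth).resolve_left ht0
    linarith
  have hAact : A ∈ activeSets (K ∩ P.extremePoints ℝ) w :=
    ⟨fun a ha => ⟨hAK a ha, hA.1 ha⟩, hA.2⟩
  obtain ⟨s, hs, hmax⟩ := Set.exists_max_image (K ∩ P.extremePoints ℝ)
    (fun u => inner ℝ u q) (hfin.subset Set.inter_subset_right) ⟨a₀, hAact.1 ha₀⟩
  have hle := pyramidalWidth_le_dirWidth hK (hKmem w hwP rfl) hqK hq0 hAact hs hmax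
  rw [← le_div_iff₀ (norm_pos_iff.2 hq0)]
  refine hle.trans (csSup_le ⟨0, s, Set.mem_insert _ _, s, Set.mem_insert _ _, by simp⟩ ?_)
  have hmem : ∀ a ∈ insert s (A : Set (EuclideanSpace ℝ (Fin n))), a ∈ K ∩ P.extremePoints ℝ := by
    rintro a (rfl | ha)
    exacts [hs, hAact.1 ha]
  rintro _ ⟨a, ha, b, hb, rfl⟩
  gcongr
  -- Since `m` is constant on `K`, the vectors `r` and `q` have the same inner products with
  -- differences of points of `K`.
  have h1 := hmax a (hmem a ha)
  rcases hb with rfl | hb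
  · rw [inner_sub_left]; linarith
  · have h2 := hG s hs.1.1 b hb
    have h3 := hKeq s hs.1
    have h4 := hKeq b (hAK b hb)
    rw [hm, inner_sub_right, inner_sub_right] at h3
    rw [hm, inner_sub_right, inner_sub_right] at h4
    rw [inner_sub_left] at h2 ⊢
    linarith

end Widths

end LFCFW

namespace LFCFW

variable {n : ℕ}

/-! ### Conjugate duality for $g$ and $h$. -/

section Duality

variable {g : EuclideanSpace ℝ (Fin n) → ℝ} {α β : ℝ}

lemma le_of_forall_one_sub_mul_le {a b : ℝ}
    (h : ∀ t : ℝ, 0 < t → t < 1 → (1 - t) * a ≤ b) : a ≤ b := by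
  have hcont : Continuous fun t : ℝ => (1 - t) * a := by fun_prop
  have hlim : Filter.Tendsto (fun t : ℝ => (1 - t) * a) (nhdsWithin 0 (Set.Ioi 0)) (nhds a) := by
    simpa using (hcont.tendsto 0).mono_left nhdsWithin_le_nhds
  exact le_of_tendsto hlim <| Filter.mem_of_superset (Ioo_mem_nhdsGT one_pos)
    fun t ht => h t ht.1 ht.2

/-- `X` minimizes `g + ⟨w, ·⟩`; the minimum is the value `h(w)` of the dual objective. -/
def IsDualMinimizer (g : EuclideanSpace ℝ (Fin n) → ℝ) (w X : EuclideanSpace ℝ (Fin n)) : Prop :=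
  ∀ x, g X + inner ℝ w X ≤ g x + inner ℝ w x

lemma exists_isDualMinimizer (hβ : 0 < β) (hg : StrongConvexOn Set.univ β g)
    (w : EuclideanSpace ℝ (Fin n)) : ∃ X, IsDualMinimizer g w X := by
  have hgc : Continuous g := continuousOn_univ.1
    ((hg.strictConvexOn hβ).convexOn.continuousOn isOpen_univ)
  set φ : EuclideanSpace ℝ (Fin n) → ℝ := fun x => g x + inner ℝ w x with hφ
  have hφc : Continuous φ := by fun_prop
  obtain ⟨m, hm⟩ : BddBelow (φ '' Metric.sphere 0 1) :=
    ((isCompact_sphere 0 1).image hφc).bddBelow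
  -- If `φ x < φ 0` with $\|x\|>R$, strong convexity on the segment from $0$ to $x$ would push `φ`
  -- below `m` on the unit sphere.
  set R : ℝ := max 1 (1 + 2 * (φ 0 - m) / β) with hR
  obtain ⟨X, -, hX⟩ := (isCompact_closedBall (0 : EuclideanSpace ℝ (Fin n)) R).exists_isMinOn
    ⟨0, by simp [hR]⟩ hφc.continuousOn
  refine ⟨X, fun x => ?_⟩
  by_cases hx : ‖x‖ ≤ R
  · exact hX (by simpa using hx)
  have hX0 : φ X ≤ φ 0 := hX (by simp [hR])
  refine hX0.trans ?_
  have h1 : 1 < ‖x‖ := (le_max_left _ _).trans_lt (not_le.1 hx)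
  have h2 : 1 + 2 * (φ 0 - m) / β < ‖x‖ := (le_max_right _ _).trans_lt (not_le.1 hx)
  have hx0 : 0 < ‖x‖ := one_pos.trans h1
  set t := ‖x‖⁻¹ with ht
  have htx : t * ‖x‖ = 1 := inv_mul_cancel₀ hx0.ne'
  have ht0 : 0 < t := inv_pos.2 hx0
  have ht1 : t < 1 := inv_lt_one_of_one_lt₀ h1
  have hmx : m ≤ φ (t • x) := hm ⟨t • x, by simp [norm_smul, ht, hx0.ne'], rfl⟩
  have hconv := hg.2 (Set.mem_univ x) (Set.mem_univ 0) ht0.le (sub_nonneg.2 ht1.le)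
    (add_sub_cancel t 1)
  simp only [smul_zero, add_zero, sub_zero, smul_eq_mul] at hconv
  have hφ0 : φ 0 = g 0 := by simp [hφ]
  have hφt : φ (t • x) = g (t • x) + t * inner ℝ w x := by simp [hφ, real_inner_smul_right]
  change φ 0 ≤ φ x
  by_contra! hlt
  have h3 : m ≤ φ 0 - t * (1 - t) * (β / 2 * ‖x‖ ^ 2) := by
    have h4 : t * φ x ≤ t * φ 0 := by gcongr
    have h5 : φ x = g x + inner ℝ w x := rfl
    rw [h5] at h4
    nlinarith
  have h6 : t * (1 - t) * (β / 2 * ‖x‖ ^ 2) = β / 2 * (‖x‖ - 1) := by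
    calc t * (1 - t) * (β / 2 * ‖x‖ ^ 2)
        = β / 2 * ((t * ‖x‖) * (‖x‖ - t * ‖x‖)) := by ring
      _ = β / 2 * (‖x‖ - 1) := by rw [htx]; ring
  have h7 : 2 * (φ 0 - m) / β < ‖x‖ - 1 := by linarith
  rw [div_lt_iff₀ hβ] at h7
  linarith

variable {w X : EuclideanSpace ℝ (Fin n)}

lemma IsDualMinimizer.dualObjective_eq (hX : IsDualMinimizer g w X) :
    dualObjective g w = g X + inner ℝ w X := by
  have h : IsGreatest (Set.range fun x => inner ℝ (-w) x - g x) (inner ℝ (-w) X - g X) := by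
    refine ⟨⟨X, rfl⟩, ?_⟩
    rintro _ ⟨x, rfl⟩
    have := hX x
    simp only [inner_neg_left]
    linarith
  rw [dualObjective, conjugate, iSup, h.csSup_eq, inner_neg_left]
  ring

lemma IsDualMinimizer.strong (hg : StrongConvexOn Set.univ β g) (hX : IsDualMinimizer g w X)
    (x : EuclideanSpace ℝ (Fin n)) :
    g X + inner ℝ w X + β / 2 * ‖x - X‖ ^ 2 ≤ g x + inner ℝ w x := by
  suffices h : β / 2 * ‖x - X‖ ^ 2 ≤ g x + inner ℝ w x - (g X + inner ℝ w X) by linarith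
  refine le_of_forall_one_sub_mul_le fun t ht ht1 => ?_
  have h1 := hg.2 (Set.mem_univ x) (Set.mem_univ X) ht.le (sub_nonneg.2 ht1.le)
    (add_sub_cancel t 1)
  have h2 := hX (t • x + (1 - t) • X)
  rw [inner_add_right, real_inner_smul_right, real_inner_smul_right] at h2
  simp only [smul_eq_mul] at h1
  refine le_of_mul_le_mul_left ?_ ht
  linarith

lemma IsDualMinimizer.smooth (hg : IsSmooth α g) (hX : IsDualMinimizer g w X)
    (x : EuclideanSpace ℝ (Fin n)) :
    g x + inner ℝ w x ≤ g X + inner ℝ w X + α / 2 * ‖x - X‖ ^ 2 := by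
  suffices h : g x + inner ℝ w x - (g X + inner ℝ w X) ≤ α / 2 * ‖x - X‖ ^ 2 by linarith
  refine le_of_forall_one_sub_mul_le fun t ht ht1 => ?_
  have h1t : 0 < 1 - t := sub_pos.2 ht1
  obtain ⟨y, rfl⟩ : ∃ y, x = X + y := ⟨x - X, by abel⟩
  -- This `e` makes `X` the convex combination of `X + y` and the backward point `X - e • y` with
  -- weights $t$ and $1-t$. Minimality at `X` bounds the backward value, so no gradient of $g$ is
  -- needed.
  set e := t / (1 - t) with he
  have het : (1 - t) * e = t := by rw [he]; field_simp
  have hcomb : (1 - t) • (X - e • y) + t • (X + y) = X := by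
    rw [smul_sub, smul_smul, het, smul_add, sub_smul, one_smul]
    abel
  have h1 := hg.2 (Set.mem_univ (X - e • y)) (Set.mem_univ (X + y)) h1t.le ht.le
    (sub_add_cancel 1 t)
  have h2 := hX (X - e • y)
  simp only [hcomb, smul_eq_mul, norm_sub_sq_real, norm_add_sq_real, norm_smul, mul_pow,
    real_inner_smul_right, Real.norm_eq_abs, sq_abs] at h1
  rw [inner_sub_right, real_inner_smul_right] at h2
  rw [inner_add_right, add_sub_cancel_left]
  have h3 : (1 - t) * (g X + inner ℝ w X) ≤
      (1 - t) * (g (X - e • y) + (inner ℝ w X - e * inner ℝ w y)) := by gcongr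
  have h4 : (1 - t) * (e * inner ℝ w y) = t * inner ℝ w y := by rw [← mul_assoc, het]
  have h5 : (1 - t) * (e * inner ℝ X y) = t * inner ℝ X y := by rw [← mul_assoc, het]
  have h6 : (1 - t) * (e ^ 2 * ‖y‖ ^ 2) = t * e * ‖y‖ ^ 2 := by
    linear_combination e * ‖y‖ ^ 2 * het
  have h7 : t * (g (X + y) + (inner ℝ w X + inner ℝ w y) - (g X + inner ℝ w X)) ≤
      t * ((1 + e) * (α / 2 * ‖y‖ ^ 2)) := by
    linear_combination h1 + h3 - h4 - α * h5 + α / 2 * h6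
  have h8 := le_of_mul_le_mul_left h7 ht
  have h9 : (1 - t) * (1 + e) = 1 := by rw [mul_add, het]; ring
  calc _ ≤ (1 - t) * ((1 + e) * (α / 2 * ‖y‖ ^ 2)) := by gcongr
    _ = α / 2 * ‖y‖ ^ 2 := by rw [← mul_assoc, h9, one_mul]

lemma dualObjective_le (hβ : 0 < β) (hg : StrongConvexOn Set.univ β g)
    (u x : EuclideanSpace ℝ (Fin n)) : dualObjective g u ≤ g x + inner ℝ u x := by
  obtain ⟨Y, hY⟩ := exists_isDualMinimizer hβ hg u
  exact hY.dualObjective_eq.trans_le (hY x)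

/-- The dual objective is strongly concave because `g` is smooth. -/
lemma IsDualMinimizer.dualObjective_upper (hα : 0 < α) (hβ : 0 < β)
    (hg : StrongConvexOn Set.univ β g) (hs : IsSmooth α g) (hX : IsDualMinimizer g w X)
    (u : EuclideanSpace ℝ (Fin n)) :
    dualObjective g u ≤ dualObjective g w + inner ℝ (u - w) X - ‖u - w‖ ^ 2 / (2 * α) := by
  -- The test point minimizes the quadratic upper model $\langle
  -- u-w,x\rangle+\frac\alpha2\|x-X\|^2$.
  have h1 := dualObjective_le hβ hg u (X - α⁻¹ • (u - w))
  have h2 := hX.smooth hs (X - α⁻¹ • (u - w))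
  rw [sub_sub_cancel_left, norm_neg, norm_smul, mul_pow, Real.norm_eq_abs, sq_abs] at h2
  have h3 : inner ℝ u (X - α⁻¹ • (u - w)) =
      inner ℝ w (X - α⁻¹ • (u - w)) + inner ℝ (u - w) X - α⁻¹ * ‖u - w‖ ^ 2 := by
    have : inner ℝ (u - w) (X - α⁻¹ • (u - w)) =
        inner ℝ (u - w) X - α⁻¹ * ‖u - w‖ ^ 2 := by
      rw [inner_sub_right, real_inner_smul_right, real_inner_self_eq_norm_sq]
    rw [inner_sub_left] at this
    linarith
  rw [hX.dualObjective_eq]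
  have h4 : α / 2 * (α⁻¹ ^ 2 * ‖u - w‖ ^ 2) = α⁻¹ * ‖u - w‖ ^ 2 / 2 := by field_simp
  have h5 : ‖u - w‖ ^ 2 / (2 * α) = α⁻¹ * ‖u - w‖ ^ 2 / 2 := by field_simp
  linarith

/-- The dual objective is smooth because `g` is strongly convex. -/
lemma IsDualMinimizer.dualObjective_lower (hβ : 0 < β) (hg : StrongConvexOn Set.univ β g)
    (hX : IsDualMinimizer g w X) (u : EuclideanSpace ℝ (Fin n)) :
    dualObjective g w + inner ℝ (u - w) X - ‖u - w‖ ^ 2 / (2 * β) ≤ dualObjective g u := by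
  obtain ⟨Y, hY⟩ := exists_isDualMinimizer hβ hg u
  rw [hX.dualObjective_eq, hY.dualObjective_eq]
  have h1 := hX.strong hg Y
  have h2 := neg_le_of_abs_le (abs_real_inner_le_norm (u - w) (Y - X))
  have h3 : 0 ≤ (‖u - w‖ - β * ‖Y - X‖) ^ 2 / (2 * β) := by positivity
  have h4 : (‖u - w‖ - β * ‖Y - X‖) ^ 2 / (2 * β) =
      ‖u - w‖ ^ 2 / (2 * β) - ‖u - w‖ * ‖Y - X‖ + β / 2 * ‖Y - X‖ ^ 2 := by
    field_simp
    ring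
  rw [inner_sub_right, inner_sub_left u w Y] at h2
  linarith

/-- The two quadratic bounds pinch $h$ around its linearization. This identifies $x^{(i)}$ with the
minimizer and gives $d^{(i)}=h(w^{(i)})$. -/
lemma IsDualMinimizer.hasGradientAt (hα : 0 < α) (hβ : 0 < β)
    (hg : StrongConvexOn Set.univ β g) (hs : IsSmooth α g) (hX : IsDualMinimizer g w X) :
    HasGradientAt (dualObjective g) X w := by
  rw [hasGradientAt_iff_isLittleO]
  refine Asymptotics.IsBigO.trans_isLittleO (g := fun u => ‖u - w‖ ^ 2) ?_ ?_
  · refine Asymptotics.IsBigO.of_bound (1 / (2 * β)) (Filter.Eventually.of_forall fun u => ?_)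
    have h1 := hX.dualObjective_lower hβ hg u
    have h2 := hX.dualObjective_upper hα hβ hg hs u
    have h3 : 0 ≤ ‖u - w‖ ^ 2 / (2 * α) := by positivity
    have h4 : 0 ≤ ‖u - w‖ ^ 2 / (2 * β) := by positivity
    rw [Real.norm_eq_abs, norm_pow, norm_norm, real_inner_comm, one_div_mul_eq_div, abs_le]
    constructor <;> linarith
  · have h : Filter.Tendsto (fun u : EuclideanSpace ℝ (Fin n) => u - w) (nhds w) (nhds 0) := by
      have hcont : Continuous fun u : EuclideanSpace ℝ (Fin n) => u - w := by fun_prop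
      simpa using hcont.tendsto w
    exact (Asymptotics.isLittleO_norm_pow_id one_lt_two).comp_tendsto h

lemma continuous_dualObjective (hα : 0 < α) (hβ : 0 < β) (hg : StrongConvexOn Set.univ β g)
    (hs : IsSmooth α g) : Continuous (dualObjective g) :=
  continuous_iff_continuousAt.2 fun w => by
    obtain ⟨X, hX⟩ := exists_isDualMinimizer hβ hg w
    exact (hX.hasGradientAt hα hβ hg hs).hasFDerivAt.continuousAt

/-- First-order optimality for maximizers of the dual objective over a convex set. -/
lemma IsDualMinimizer.inner_le_of_isMaxOn (hβ : 0 < β) (hg : StrongConvexOn Set.univ β g)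
    (hX : IsDualMinimizer g w X) {C : Set (EuclideanSpace ℝ (Fin n))} (hC : Convex ℝ C)
    (hw : w ∈ C) (hmax : ∀ u ∈ C, dualObjective g u ≤ dualObjective g w)
    {u : EuclideanSpace ℝ (Fin n)} (hu : u ∈ C) : inner ℝ u X ≤ inner ℝ w X := by
  suffices h : ∀ t : ℝ, 0 < t → t < 1 → inner ℝ (u - w) X ≤ t * (‖u - w‖ ^ 2 / (2 * β)) by
    have h0 : inner ℝ (u - w) X + ‖u - w‖ ^ 2 / (2 * β) * 0 ≤ 0 := by
      have hcont : Continuous fun t : ℝ => t * (‖u - w‖ ^ 2 / (2 * β)) := by fun_prop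
      have hlim : Filter.Tendsto (fun t : ℝ => t * (‖u - w‖ ^ 2 / (2 * β)))
          (nhdsWithin 0 (Set.Ioi 0)) (nhds 0) := by
        simpa using (hcont.tendsto 0).mono_left nhdsWithin_le_nhds
      rw [mul_zero, add_zero]
      exact ge_of_tendsto hlim <| Filter.mem_of_superset (Ioo_mem_nhdsGT one_pos)
        fun t ht => h t ht.1 ht.2
    rw [inner_sub_left] at h0
    linarith
  intro t ht ht1
  have h1 := hX.dualObjective_lower hβ hg (w + t • (u - w))
  have h2 := hmax _ (hC.add_smul_sub_mem hw hu ⟨ht.le, ht1.le⟩)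
  rw [add_sub_cancel_left, real_inner_smul_left, norm_smul, mul_pow, Real.norm_eq_abs,
    sq_abs] at h1
  refine le_of_mul_le_mul_left ?_ ht
  calc t * inner ℝ (u - w) X ≤ t ^ 2 * ‖u - w‖ ^ 2 / (2 * β) := by linarith
    _ = t * (t * (‖u - w‖ ^ 2 / (2 * β))) := by ring

/-- The two quadratic bounds on $h(u)$ must be compatible. Distinct points are required because
dimension zero imposes no relation. -/
lemma smoothness_ge_strongConvexity (hα : 0 < α) (hβ : 0 < β)
    (hg : StrongConvexOn Set.univ β g) (hs : IsSmooth α g)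
    {u w : EuclideanSpace ℝ (Fin n)} (huw : u ≠ w) : β ≤ α := by
  obtain ⟨X, hX⟩ := exists_isDualMinimizer hβ hg w
  have h1 := hX.dualObjective_lower hβ hg u
  have h2 := hX.dualObjective_upper hα hβ hg hs u
  have h3 : 0 < ‖u - w‖ ^ 2 := by
    have := norm_pos_iff.2 (sub_ne_zero.2 huw)
    positivity
  have h4 : ‖u - w‖ ^ 2 / (2 * α) ≤ ‖u - w‖ ^ 2 / (2 * β) := by linarith
  rw [div_le_div_iff₀ (by positivity) (by positivity)] at h4
  have := le_of_mul_le_mul_left h4 h3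
  linarith

variable {P : Set (EuclideanSpace ℝ (Fin n))}

lemma inner_le_supportFun (hP : IsCompact P) (hw : w ∈ P) (x : EuclideanSpace ℝ (Fin n)) :
    inner ℝ w x ≤ supportFun P x :=
  le_csSup (hP.image (by fun_prop : Continuous fun w => inner ℝ w x)).bddAbove ⟨w, hw, rfl⟩

lemma dualObjective_le_primal (hβ : 0 < β) (hg : StrongConvexOn Set.univ β g)
    (hP : IsCompact P) (hw : w ∈ P) (x : EuclideanSpace ℝ (Fin n)) :
    dualObjective g w ≤ g x + supportFun P x :=
  (dualObjective_le hβ hg w x).trans (by gcongr; exact inner_le_supportFun hP hw x)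

/-- Weak duality. -/
lemma dualObjective_le_primalValue (hβ : 0 < β) (hg : StrongConvexOn Set.univ β g)
    (hP : IsCompact P) (hw : w ∈ P) : dualObjective g w ≤ primalValue g P :=
  le_ciInf (dualObjective_le_primal hβ hg hP hw)

/-- Strong duality: the primal value is attained by the dual objective on the polytope. -/
theorem exists_dualObjective_eq_primalValue (hα : 0 < α) (hβ : 0 < β)
    (hg : StrongConvexOn Set.univ β g) (hs : IsSmooth α g) (hP : IsCompact P)
    (hconv : Convex ℝ P) (hne : P.Nonempty) :
    ∃ w ∈ P, dualObjective g w = primalValue g P := by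
  obtain ⟨w, hw, hmax⟩ := hP.exists_isMaxOn hne
    (continuous_dualObjective hα hβ hg hs).continuousOn
  refine ⟨w, hw, (dualObjective_le_primalValue hβ hg hP hw).antisymm ?_⟩
  obtain ⟨X, hX⟩ := exists_isDualMinimizer hβ hg w
  have hbdd : BddBelow (Set.range fun x => g x + supportFun P x) := by
    refine ⟨dualObjective g w, ?_⟩
    rintro _ ⟨x, rfl⟩
    exact dualObjective_le_primal hβ hg hP hw x
  -- At the dual maximizer, first-order optimality gives $f(X)\le w^\top X$, so `X` closes the
  -- duality gap.
  refine (ciInf_le hbdd X).trans ?_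
  rw [hX.dualObjective_eq]
  gcongr
  refine csSup_le (hne.image _) ?_
  rintro _ ⟨u, hu, rfl⟩
  exact hX.inner_le_of_isMaxOn hβ hg hconv hw hmax hu

end Duality

end LFCFW

namespace LFCFW

variable {n : ℕ}

/-! ### Contraction of the dual error in one step. -/

section Rate

variable {P : Set (EuclideanSpace ℝ (Fin n))}

/-- The gap inequality for the direction $r=y-w$ itself, with Cauchy-Schwarz bounding the gap. -/
lemma pyramidalWidth_le_diam (hc : IsCompact P) (hconv : Convex ℝ P)
    (hfin : (P.extremePoints ℝ).Finite) (hP : P.Nontrivial) :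
    pyramidalWidth P ≤ Metric.diam P := by
  obtain ⟨w, hw, y, hy, hne⟩ := hP
  obtain ⟨A, hA⟩ := activeSets_nonempty hfin (eq_convexHull_extremePoints hc hconv hfin ▸ hw)
  have h := pyramidalWidth_mul_inner_le (r := y - w) (G := Metric.diam P * ‖y - w‖)
    hc hconv hfin hA hy fun s hs a ha => by
      refine (real_inner_le_norm _ _).trans ?_
      gcongr
      rw [← dist_eq_norm]
      exact Metric.dist_le_diam_of_mem hc.isBounded hs (hA.1 ha).1
  have hpos : 0 < ‖y - w‖ := norm_pos_iff.2 (sub_ne_zero.2 hne.symm)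
  rw [real_inner_self_eq_norm_mul_norm, mul_assoc (Metric.diam P)] at h
  exact le_of_mul_le_mul_right h (by positivity)

lemma diam_pos (hc : IsCompact P) (hP : P.Nontrivial) : 0 < Metric.diam P := by
  obtain ⟨w, hw, y, hy, hne⟩ := hP
  exact (dist_pos.2 hne).trans_le (Metric.dist_le_diam_of_mem hc.isBounded hw hy)

/-- The progress of a line search against an error bound: `D` is the current error, `S` the slope
towards the optimum at distance `s`, `G` the gap, `m ≤ M` the length of the search segment and
`Δ` the progress. -/
lemma rate_mul_error_le_progress {α β δ M D S s G m Δ : ℝ} (hα : 0 < α) (hβ : 0 < β)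
    (hβα : β ≤ α) (hδ : 0 ≤ δ) (hδM : δ ≤ M) (hM : 0 < M) (hm : 0 ≤ m) (hmM : m ≤ M)
    (hD : 0 ≤ D) (hDS : D ≤ S - s ^ 2 / (2 * α)) (hSG : S ≤ G) (hδS : δ * S ≤ G * s)
    (hΔ : ∀ t : ℝ, 0 ≤ t → t ≤ 1 → t * G - t ^ 2 * m ^ 2 / (2 * β) ≤ Δ) :
    β / (4 * α) * (δ / M) ^ 2 * D ≤ Δ := by
  have hs : 0 ≤ s ^ 2 / (2 * α) := by positivity
  have hDG : D ≤ G := by linarith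
  have hm2 : m ^ 2 ≤ M ^ 2 := by gcongr
  -- The unconstrained maximizer of $tG-t^2M^2/(2\beta)$ is $t=\beta G/M^2$; the cases are whether
  -- it is at most $1$. Otherwise the full step gains at least $G/2\ge D/2$.
  rcases le_or_gt (β * G) (M ^ 2) with hcase | hcase
  · have h1 : δ ^ 2 * D ≤ α * G ^ 2 / 2 := by
      have h2 : δ ^ 2 * D ≤ δ * (G * s) - δ ^ 2 * s ^ 2 / (2 * α) := by
        calc δ ^ 2 * D ≤ δ ^ 2 * (S - s ^ 2 / (2 * α)) := by gcongr
          _ = δ * (δ * S) - δ ^ 2 * s ^ 2 / (2 * α) := by ring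
          _ ≤ _ := by gcongr
      have h3 : 0 ≤ (α * G - δ * s) ^ 2 / (2 * α) := by positivity
      have h4 : (α * G - δ * s) ^ 2 / (2 * α) =
          α * G ^ 2 / 2 - δ * (G * s) + δ ^ 2 * s ^ 2 / (2 * α) := by
        field_simp
        ring
      linarith
    have hG : 0 ≤ G := hD.trans hDG
    have h5 := hΔ (β * G / M ^ 2) (by positivity) (by rwa [div_le_one (by positivity)])
    have h6 : (β * G / M ^ 2) ^ 2 * m ^ 2 / (2 * β) ≤ (β * G / M ^ 2) ^ 2 * M ^ 2 / (2 * β) := by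
      gcongr
    have h7 : (β * G / M ^ 2) ^ 2 * M ^ 2 / (2 * β) = β * G ^ 2 / (2 * M ^ 2) := by
      field_simp
    have h8 : β * G / M ^ 2 * G = 2 * (β * G ^ 2 / (2 * M ^ 2)) := by
      field_simp
    have h9 : 0 ≤ β * G ^ 2 / (2 * M ^ 2) := by positivity
    calc β / (4 * α) * (δ / M) ^ 2 * D = β / (4 * α * M ^ 2) * (δ ^ 2 * D) := by
          field_simp
      _ ≤ β / (4 * α * M ^ 2) * (α * G ^ 2 / 2) := by gcongr
      _ = β * G ^ 2 / (2 * M ^ 2) / 4 := by field_simp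
      _ ≤ Δ := by linarith
  · have h1 := hΔ 1 zero_le_one le_rfl
    rw [one_mul, one_pow, one_mul] at h1
    have h2 : m ^ 2 / (2 * β) ≤ G / 2 := by
      rw [div_le_div_iff₀ (by positivity) two_pos]
      linarith
    have h3 : β / (4 * α) ≤ 1 / 4 := by
      rw [div_le_div_iff₀ (by positivity) (by norm_num)]
      linarith
    have h4 : (δ / M) ^ 2 ≤ 1 := pow_le_one₀ (by positivity) ((div_le_one hM).2 hδM)
    calc β / (4 * α) * (δ / M) ^ 2 * D ≤ 1 / 4 * 1 * D := by gcongr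
      _ ≤ Δ := by linarith

variable {g : EuclideanSpace ℝ (Fin n) → ℝ} {α β : ℝ}

/-- One step of a fully corrective method contracts the dual error: `w` is orthogonal to its active
set with respect to the gradient `X`, and the value `d` is at least that of the best point of the
segment from `w` to the Frank-Wolfe vertex `v`. -/
lemma primalValue_sub_le_of_step (hα : 0 < α) (hβ : 0 < β) (hs : IsSmooth α g)
    (hg : StrongConvexOn Set.univ β g) (hc : IsCompact P) (hconv : Convex ℝ P)
    (hfin : (P.extremePoints ℝ).Finite) (hP : P.Nontrivial)
    {w v X : EuclideanSpace ℝ (Fin n)} {A : Finset (EuclideanSpace ℝ (Fin n))} {d : ℝ}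
    (hA : A ∈ activeSets (P.extremePoints ℝ) w) (hX : IsDualMinimizer g w X)
    (hAX : ∀ a ∈ A, inner ℝ a X = inner ℝ w X) (hv : v ∈ P)
    (hmax : ∀ u ∈ P, inner ℝ u X ≤ inner ℝ v X)
    (hd : ∀ t : ℝ, 0 ≤ t → t ≤ 1 → dualObjective g (w + t • (v - w)) ≤ d) :
    primalValue g P - d ≤
      (1 - β / (4 * α) * (pyramidalWidth P / Metric.diam P) ^ 2) *
        (primalValue g P - dualObjective g w) := by
  obtain ⟨z, hz, hzp⟩ := exists_dualObjective_eq_primalValue hα hβ hg hs hc hconv hP.nonempty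
  have hwP : w ∈ P := convexHull_min (fun a ha => (hA.1 ha).1) hconv
    (mem_convexHull_of_mem_activeSets hA)
  obtain ⟨a, ha, b, hb, hab⟩ := id hP
  have h1 := hX.dualObjective_upper hα hβ hg hs z
  have hgap : ∀ u ∈ P, ∀ e ∈ A, inner ℝ (u - e) X ≤ inner ℝ (v - w) X := fun u hu e he => by
    rw [inner_sub_left, inner_sub_left, hAX e he]
    linarith [hmax u hu]
  have h2 := rate_mul_error_le_progress (D := primalValue g P - dualObjective g w)
    (S := inner ℝ (z - w) X) (s := ‖z - w‖) (G := inner ℝ (v - w) X) (m := ‖v - w‖)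
    (Δ := d - dualObjective g w) hα hβ (smoothness_ge_strongConvexity hα hβ hg hs hab)
    (pyramidalWidth_nonneg P) (pyramidalWidth_le_diam hc hconv hfin hP) (diam_pos hc hP)
    (norm_nonneg _) (by rw [← dist_eq_norm]; exact Metric.dist_le_diam_of_mem hc.isBounded hv hwP)
    (sub_nonneg.2 (dualObjective_le_primalValue hβ hg hc hwP)) (by linarith)
    (by rw [inner_sub_left, inner_sub_left]; linarith [hmax z hz])
    (pyramidalWidth_mul_inner_le hc hconv hfin hA hz hgap) fun t ht ht1 => by
      have h3 := hX.dualObjective_lower hβ hg (w + t • (v - w))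
      rw [add_sub_cancel_left, real_inner_smul_left, norm_smul, mul_pow, Real.norm_eq_abs,
        sq_abs] at h3
      linarith [hd t ht ht1]
  linarith

end Rate

/-! ### Invariants of a run of the algorithm. -/

namespace Run

variable {g : EuclideanSpace ℝ (Fin n) → ℝ} {P : Set (EuclideanSpace ℝ (Fin n))} {ε α β : ℝ}
  {N : ℕ} (R : Run g P ε N)

lemma V_subset {i : ℕ} (hi : i < N) :
    (R.V i : Set (EuclideanSpace ℝ (Fin n))) ⊆ P.extremePoints ℝ := by
  cases i with
  | zero => exact R.init_vertices
  | succ i =>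
    rw [R.V_update i hi]
    exact Set.insert_subset (R.v_vertex i (by omega)) (R.B_vertices i hi)

lemma w_mem_polytope (hconv : Convex ℝ P) {i : ℕ} (hi : i < N) : R.w (i + 1) ∈ P :=
  convexHull_min ((R.V_subset hi).trans extremePoints_subset) hconv (R.w_mem i hi)

lemma isDualMinimizer_x (hα : 0 < α) (hβ : 0 < β) (hg : StrongConvexOn Set.univ β g)
    (hs : IsSmooth α g) {i : ℕ} (hi : i < N) :
    IsDualMinimizer g (R.w (i + 1)) (R.x (i + 1)) := by
  obtain ⟨X, hX⟩ := exists_isDualMinimizer hβ hg (R.w (i + 1))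
  rwa [R.x_eq i hi, (hX.hasGradientAt hα hβ hg hs).gradient]

lemma lowerBound_eq (hα : 0 < α) (hβ : 0 < β) (hg : StrongConvexOn Set.univ β g)
    (hs : IsSmooth α g) {i : ℕ} (hi : i < N) :
    R.lowerBound (i + 1) = dualObjective g (R.w (i + 1)) :=
  (R.isDualMinimizer_x hα hβ hg hs hi).dualObjective_eq.symm

/-- The vertices with positive multiplier in iteration `i + 1`. -/
noncomputable def active (i : ℕ) : Finset (EuclideanSpace ℝ (Fin n)) :=
  (R.V i).filter fun u => 0 < R.lam (i + 1) u

lemma active_mem_activeSets {i : ℕ} (hi : i < N) :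
    R.active i ∈ activeSets (R.V i : Set (EuclideanSpace ℝ (Fin n))) (R.w (i + 1)) :=
  filter_pos_mem_activeSets subset_rfl (R.lam_nonneg i hi) (R.lam_sum i hi) (R.lam_repr i hi)

lemma active_subset {i : ℕ} (hi : i + 1 < N) :
    (R.active i : Set (EuclideanSpace ℝ (Fin n))) ⊆ R.V (i + 1) := fun u hu => by
  obtain ⟨huV, hpos⟩ := Finset.mem_filter.1 (Finset.mem_coe.1 hu)
  rw [R.V_update i hi]
  exact Set.mem_insert_of_mem _ (R.B_active i hi u huV hpos)

/-- This is why the fully corrective step dominates line search: discarding inactive vertices never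
loses `w`. -/
lemma segment_subset {i : ℕ} (hi : i + 1 < N) {t : ℝ} (ht : 0 ≤ t) (ht1 : t ≤ 1) :
    R.w (i + 1) + t • (R.v (i + 1) - R.w (i + 1)) ∈
      convexHull ℝ (R.V (i + 1) : Set (EuclideanSpace ℝ (Fin n))) := by
  refine (convex_convexHull ℝ _).add_smul_sub_mem ?_ (subset_convexHull ℝ _ ?_) ⟨ht, ht1⟩
  · exact convexHull_mono (R.active_subset hi)
      (mem_convexHull_of_mem_activeSets (R.active_mem_activeSets (by omega)))
  · rw [R.V_update i hi]
    exact Set.mem_insert _ _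

end Run

end LFCFW

/-! ### Assembly of the theorem. -/

theorem theorem5p1 {n : ℕ} (g : EuclideanSpace ℝ (Fin n) → ℝ) (α β : ℝ)
    (hα : 0 < α) (hβ : 0 < β)
    (hsmooth : LFCFW.IsSmooth α g) (hstrong : StrongConvexOn Set.univ β g)
    (P : Set (EuclideanSpace ℝ (Fin n)))
    (hP : LFCFW.IsPolytope P ∨
      ∃ F : Finset (Fin n) → ℝ, LFCFW.IsSubmodular F ∧ F ∅ = 0 ∧ P = LFCFW.basePolytope F)
    (M δ ρ : ℝ) (hM : M = Metric.diam P) (hδ : δ = LFCFW.pyramidalWidth P)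
    (hρ : ρ = β / (4 * α) * (δ / M) ^ 2) :
    (P.Nontrivial → 0 < ρ) ∧
    ∀ (ε : ℝ) (N : ℕ) (R : LFCFW.Run g P ε N),
      (∀ i, 1 ≤ i → i ≤ N →
        R.lowerBound i = LFCFW.dualObjective g (R.w i) ∧
        R.lowerBound i ≤ LFCFW.primalValue g P) ∧
      (∀ i, 1 ≤ i → i + 1 ≤ N →
        LFCFW.primalValue g P - R.lowerBound (i + 1) ≤
          (1 - ρ) * (LFCFW.primalValue g P - R.lowerBound i)) := by
  obtain ⟨hc, hconv, hfin⟩ := LFCFW.compact_convex_finite_extremePoints (P := P)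
    (hP.imp_right fun ⟨F, _, _, hF⟩ => ⟨F, hF⟩)
  subst hM hδ hρ
  refine ⟨fun hne => ?_, fun ε N R => ⟨fun i h1 hN => ?_, fun i h1 hN => ?_⟩⟩
  · have := LFCFW.pyramidalWidth_pos hc hconv hfin hne
    have := LFCFW.diam_pos hc hne
    positivity
  · obtain ⟨i, rfl⟩ := Nat.exists_eq_add_of_le' h1
    rw [R.lowerBound_eq hα hβ hstrong hsmooth hN]
    exact ⟨rfl, LFCFW.dualObjective_le_primalValue hβ hstrong hc (R.w_mem_polytope hconv hN)⟩
  · obtain ⟨i, rfl⟩ := Nat.exists_eq_add_of_le' h1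
    have hi : i < N := by omega
    rw [R.lowerBound_eq hα hβ hstrong hsmooth hN, R.lowerBound_eq hα hβ hstrong hsmooth hi]
    have hact := R.active_mem_activeSets hi
    have hX := R.isDualMinimizer_x hα hβ hstrong hsmooth hi
    have hd : ∀ t : ℝ, 0 ≤ t → t ≤ 1 →
        LFCFW.dualObjective g (R.w (i + 1) + t • (R.v (i + 1) - R.w (i + 1))) ≤
          LFCFW.dualObjective g (R.w (i + 1 + 1)) := fun t ht ht1 =>
      R.w_max (i + 1) hN _ (R.segment_subset hN ht ht1)
    by_cases hne : P.Nontrivial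
    · refine LFCFW.primalValue_sub_le_of_step hα hβ hsmooth hstrong hc hconv hfin hne
        ⟨hact.1.trans (R.V_subset hi), hact.2⟩ hX (LFCFW.inner_eq_of_mem_activeSets hact ?_)
        (R.v_vertex i hi).1 (R.v_max i hi) hd
      -- Optimality over the memory hull gives one inequality at each active vertex; complementary
      -- slackness upgrades it to equality.
      exact fun a ha => hX.inner_le_of_isMaxOn hβ hstrong (convex_convexHull ℝ _) (R.w_mem i hi)
        (R.w_max i hi) (subset_convexHull ℝ _ (hact.1 ha))
    -- For a single point the diameter is $0$ and division by zero gives $\rho=0$, so monotonicity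
    -- of the bounds (the case $t=0$) suffices.
    · have h0 := hd 0 le_rfl zero_le_one
      rw [zero_smul, add_zero] at h0
      rw [Metric.diam_subsingleton (Set.not_nontrivial_iff.1 hne)]
      simp only [div_zero, ne_eq, OfNat.ofNat_ne_zero, not_false_eq_true, zero_pow, mul_zero,
        sub_zero, one_mul]
      linarith
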